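/- Let $n\ge 2$, let $q\in\mathbb C\setminus\{0\}$ not be a root of unity, fix $\tau\in\mathbb C$ with $e^{\tau}=q$, and put $q^x=e^{\tau x}$ and $[x]_q=\dfrac{q^x-q^{-x}}{q-q^{-1}}$ for $x\in\mathbb C$. Let $1(q)=\{x\in\mathbb C: q^x=1\}$. Let $\mathfrak h=\bigoplus_{k=1}^n\mathbb C\epsilon_k$, $\alpha_i=\epsilon_i-\epsilon_{i+1}\in\mathfrak h$ and $\langle \sum_k h_k\epsilon_k,\alpha_i\rangle=h_i-h_{i+1}$ for $1\le i\le n-1$. Let $U_q=U_q(\mathfrak{gl}_n)$ be the unital associative $\mathbb C$-algebra with generators $e_i,f_i$ $(1\le i\le n-1)$ and $q^h$ $(h\in\mathfrak h)$ and relations $q^0=1$, $q^hq^{h'}=q^{h+h'}$, $q^he_iq^{-h}=q^{\langle h,\alpha_i\rangle}e_i$, $q^hf_iq^{-h}=q^{-\langle h,\alpha_i\rangle}f_i$, $e_if_j-f_je_i=\delta_{ij}\dfrac{q^{\alpha_i}-q^{-\alpha_i}}{q-q^{-1}}$, $e_i^2e_j-(q+q^{-1})e_ie_je_i+e_je_i^2=0=f_i^2f_j-(q+q^{-1})f_if_jf_i+f_jf_i^2$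 for $|i-j|=1$, and $e_ie_j=e_je_i$, $f_if_j=f_jf_i$ for $|i-j|>1$. A Gelfand–Tsetlin tableau of height $n$ is an array $T(L)$ with complex entries $l_{ij}$, $1\le j\le i\le n$. It is called generic if $l_{ki}-l_{kj}\notin\mathbb Z+\tfrac12 1(q)$ for all $1\le k\le n-1$ and $1\le i\ne j\le k$. Let $V_\emptyset(T(L))$ be the complex vector space with basis all integral shifts $T(L+z)$, where $z=(z_{ij})$ has integer entries and $z_{nj}=0$ for all $j$. For $1\le j\le k\le n-1$ let $\delta^{kj}$ be the array with $1$ in position $(k,j)$ and $0$ elsewhere. Let $T(L)$ be a generic Gelfand–Tsetlin tableau of height $n$. Then $V_\emptyset(T(L))$ has a structure of a $U_q$-module such that every basis tableau $T(R)$, $R=(r_{ij})$, satisfies the Gelfand–Tsetlin formulas $$q^{\epsilon_k}T(R)=q^{a_k}T(R),\qquad a_k=\sum_{i=1}^k r_{ki}-\sum_{i=1}^{k-1}r_{k-1,i}+k\qquad(1\le k\le n),$$ more generally $q^{h}T(R)=q^{\sum_k h_ka_k}T(R)$ for $h=\sum_k h_k\epsilon_k\in\mathfrak h$, and, for $1\le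 k\le n-1$, $$e_kT(R)=-\sum_{j=1}^k\frac{\prod_{i=1}^{k+1}[r_{k+1,i}-r_{kj}]_q}{\prod_{i\ne j}[r_{ki}-r_{kj}]_q}\,T(R+\delta^{kj}),\qquad f_kT(R)=\sum_{j=1}^k\frac{\prod_{i=1}^{k-1}[r_{k-1,i}-r_{kj}]_q}{\prod_{i\ne j}[r_{ki}-r_{kj}]_q}\,T(R-\delta^{kj}),$$ where $\prod_{i\neq j}$ runs over $1\le i\le k$, $i\ne j$. -/

import Mathlib

noncomputable section

namespace QuantumGT

open scoped BigOperators

/-! Throughout, `τ : ℂ` is a fixed logarithm of `q`, so `q = exp τ` and `q ^ x = exp (τ x)` for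
complex `x`. -/

/-- The complex power `q ^ x`, where `q = exp τ`. -/
def qPow (τ x : ℂ) : ℂ := Complex.exp (τ * x)

/-- The `q`-number `[x]_q = (q ^ x - q ^ (-x)) / (q - q ^ (-1))`. -/
def qNum (τ x : ℂ) : ℂ :=
  (qPow τ x - qPow τ (-x)) / (qPow τ 1 - qPow τ (-1))

/-! ### The quantum enveloping algebra of `gl_n` -/

/-- The Cartan subalgebra of diagonal matrices: `h k` is the coefficient of `ε_{k+1}`. -/
abbrev Cartan (n : ℕ) : Type := Fin n → ℂ

/-- The basis element `ε_{k+1}`. -/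
def eps {n : ℕ} (k : Fin n) : Cartan n := Pi.single k 1

/-- The index `i` viewed as a row number among `0, …, n - 1`. -/
def lo {n : ℕ} (i : Fin (n - 1)) : Fin n := ⟨i, by omega⟩

/-- The index `i + 1` viewed as a row number among `0, …, n - 1`. -/
def hi {n : ℕ} (i : Fin (n - 1)) : Fin n := ⟨i + 1, by omega⟩

/-- The simple root `α_{i+1} = ε_{i+1} - ε_{i+2}`, as an element of the Cartan subalgebra. -/
def simpleRoot {n : ℕ} (i : Fin (n - 1)) : Cartan n := eps (lo i) - eps (hi i)

/-- The pairing `⟨h, α_{i+1}⟩`. -/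
def rootPairing {n : ℕ} (h : Cartan n) (i : Fin (n - 1)) : ℂ := h (lo i) - h (hi i)

/-- Generators: `e i` is `e_{i+1}`, `f i` is `f_{i+1}`, and `qh h` is `q ^ h`. -/
inductive Gen (n : ℕ) : Type
  | e (i : Fin (n - 1)) : Gen n
  | f (i : Fin (n - 1)) : Gen n
  | qh (h : Cartan n) : Gen n

/-- The generators as elements of the free algebra. -/
abbrev gE {n : ℕ} (i : Fin (n - 1)) : FreeAlgebra ℂ (Gen n) := FreeAlgebra.ι ℂ (Gen.e i)
abbrev gF {n : ℕ} (i : Fin (n - 1)) : FreeAlgebra ℂ (Gen n) := FreeAlgebra.ι ℂ (Gen.f i)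
abbrev gQ {n : ℕ} (h : Cartan n) : FreeAlgebra ℂ (Gen n) := FreeAlgebra.ι ℂ (Gen.qh h)

/-- Adjacent indices: `|i - j| = 1`. -/
def Adjacent {m : ℕ} (i j : Fin m) : Prop := (i : ℕ) + 1 = j ∨ (j : ℕ) + 1 = i

/-- Distant indices: `|i - j| > 1`. -/
def Distant {m : ℕ} (i j : Fin m) : Prop := (i : ℕ) + 1 < j ∨ (j : ℕ) + 1 < i

/-- The defining relations of `U_q(gl_n)`. -/
inductive UqRel (n : ℕ) (τ : ℂ) : FreeAlgebra ℂ (Gen n) → FreeAlgebra ℂ (Gen n) → Prop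
  | qh_zero : UqRel n τ (gQ 0) 1
  | qh_add (h h' : Cartan n) : UqRel n τ (gQ h * gQ h') (gQ (h + h'))
  | qh_e (h : Cartan n) (i : Fin (n - 1)) :
      UqRel n τ (gQ h * gE i * gQ (-h)) (qPow τ (rootPairing h i) • gE i)
  | qh_f (h : Cartan n) (i : Fin (n - 1)) :
      UqRel n τ (gQ h * gF i * gQ (-h)) (qPow τ (-rootPairing h i) • gF i)
  | ef_same (i : Fin (n - 1)) :
      UqRel n τ (gE i * gF i - gF i * gE i)
        ((qPow τ 1 - qPow τ (-1))⁻¹ • (gQ (simpleRoot i) - gQ (-simpleRoot i)))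
  | ef_ne (i j : Fin (n - 1)) (hij : i ≠ j) : UqRel n τ (gE i * gF j - gF j * gE i) 0
  | serre_e (i j : Fin (n - 1)) (hij : Adjacent i j) :
      UqRel n τ
        (gE i ^ 2 * gE j - (qPow τ 1 + qPow τ (-1)) • (gE i * gE j * gE i) + gE j * gE i ^ 2) 0
  | serre_f (i j : Fin (n - 1)) (hij : Adjacent i j) :
      UqRel n τ
        (gF i ^ 2 * gF j - (qPow τ 1 + qPow τ (-1)) • (gF i * gF j * gF i) + gF j * gF i ^ 2) 0
  | comm_e (i j : Fin (n - 1)) (hij : Distant i j) : UqRel n τ (gE i * gE j) (gE j * gE i)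
  | comm_f (i j : Fin (n - 1)) (hij : Distant i j) : UqRel n τ (gF i * gF j) (gF j * gF i)

/-- The quantum enveloping algebra `U_q(gl_n)`, `q = exp τ`. -/
abbrev Uq (n : ℕ) (τ : ℂ) : Type := RingQuot (UqRel n τ)

/-- The element `e_{i+1}` of `U_q(gl_n)`. -/
def Uq.e {n : ℕ} (τ : ℂ) (i : Fin (n - 1)) : Uq n τ := RingQuot.mkAlgHom ℂ (UqRel n τ) (gE i)

/-- The element `f_{i+1}` of `U_q(gl_n)`. -/
def Uq.f {n : ℕ} (τ : ℂ) (i : Fin (n - 1)) : Uq n τ := RingQuot.mkAlgHom ℂ (UqRel n τ) (gF i)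

/-- The element `q ^ h` of `U_q(gl_n)`. -/
def Uq.qh {n : ℕ} (τ : ℂ) (h : Cartan n) : Uq n τ := RingQuot.mkAlgHom ℂ (UqRel n τ) (gQ h)

/-! ### Gelfand–Tsetlin tableaux -/

/-- The positions `(i, j)` with `1 ≤ j ≤ i ≤ n`. -/
abbrev Pos (n : ℕ) : Type := {p : ℕ × ℕ // 1 ≤ p.2 ∧ p.2 ≤ p.1 ∧ p.1 ≤ n}

/-- Gelfand–Tsetlin tableaux of height `n`. -/
abbrev Tableau (n : ℕ) : Type := Pos n → ℂ

/-- The entry `l_{ij}`; only positions with `1 ≤ j ≤ i ≤ n` are ever used. -/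
def entry {n : ℕ} (L : Tableau n) (i j : ℕ) : ℂ :=
  if h : 1 ≤ j ∧ j ≤ i ∧ i ≤ n then L ⟨(i, j), h⟩ else 0

/-- The tableau `δ^{kj}`: it is `1` at `(k, j)` and `0` elsewhere. -/
def delta (n k j : ℕ) : Tableau n := fun p => if p.1 = (k, j) then 1 else 0

/-- `L` is generic: no difference of two entries in a common row `k ≤ n - 1` lies in
`ℤ + 1(q)/2`, where `1(q) = {x | q ^ x = 1}`. -/
def IsGeneric {n : ℕ} (τ : ℂ) (L : Tableau n) : Prop :=
  ∀ k i j : ℕ, k < n → 1 ≤ i → i ≤ k → 1 ≤ j → j ≤ k → i ≠ j →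
    ¬ ∃ (m : ℤ) (x : ℂ), qPow τ x = 1 ∧ entry L k i - entry L k j = (m : ℂ) + x / 2

/-- `R` is an integral shift of `L`: `R = L + z` with `z` integral and zero in the top row. -/
def IsShift {n : ℕ} (L R : Tableau n) : Prop :=
  ∃ z : Pos n → ℤ, (∀ p : Pos n, p.1.1 = n → z p = 0) ∧ R = fun p => L p + (z p : ℂ)

/-- All integral shifts of a generic tableau are generic. -/
theorem IsGeneric.of_isShift {n : ℕ} {τ : ℂ} {L R : Tableau n} (hL : IsGeneric τ L)
    (hR : IsShift L R) : IsGeneric τ R := by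
  obtain ⟨z, -, rfl⟩ := hR
  rintro k i j hk hi hik hj hjk hij ⟨m, x, hx, h⟩
  refine hL k i j hk hi hik hj hjk hij
    ⟨m - z ⟨(k, i), hi, hik, hk.le⟩ + z ⟨(k, j), hj, hjk, hk.le⟩, x, hx, ?_⟩
  have e1 : 1 ≤ i ∧ i ≤ k ∧ k ≤ n := ⟨hi, hik, hk.le⟩
  have e2 : 1 ≤ j ∧ j ≤ k ∧ k ≤ n := ⟨hj, hjk, hk.le⟩
  simp only [entry, dif_pos e1, dif_pos e2] at h ⊢
  push_cast
  linear_combination h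

/-- The set of basis tableaux `B_∅(T(L))`. -/
def basisTableaux {n : ℕ} (L : Tableau n) : Set (Tableau n) := {R | IsShift L R}

/-- The vector space `V_∅(T(L))` with basis the integral shifts of `L`, inside the vector space of
formal linear combinations of tableaux. -/
def V {n : ℕ} (L : Tableau n) : Submodule ℂ (Tableau n →₀ ℂ) :=
  Submodule.span ℂ ((fun R => Finsupp.single R (1 : ℂ)) '' basisTableaux L)

/-- The tableau `R`, as a vector of `V_∅(T(L))`. -/
def tab {n : ℕ} {L R : Tableau n} (hR : R ∈ basisTableaux L) : V L :=
  ⟨Finsupp.single R 1, Submodule.subset_span ⟨R, hR, rfl⟩⟩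

/-! ### Coefficients of the Gelfand–Tsetlin formulas (rows and columns numbered from `1`) -/

/-- `a_k = ∑_{i=1}^{k} l_{ki} - ∑_{i=1}^{k-1} l_{k-1,i} + k`. -/
def aCoeff {n : ℕ} (L : Tableau n) (k : ℕ) : ℂ :=
  (∑ i ∈ Finset.Icc 1 k, entry L k i) - (∑ i ∈ Finset.Icc 1 (k - 1), entry L (k - 1) i) + (k : ℂ)

/-- `-(∏_{i=1}^{k+1} [l_{k+1,i} - l_{kj}]) / ∏_{i ≠ j} [l_{ki} - l_{kj}]`. -/
def eCoeff {n : ℕ} (τ : ℂ) (L : Tableau n) (k j : ℕ) : ℂ :=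
  -((∏ i ∈ Finset.Icc 1 (k + 1), qNum τ (entry L (k + 1) i - entry L k j)) /
    ∏ i ∈ (Finset.Icc 1 k).erase j, qNum τ (entry L k i - entry L k j))

/-- `(∏_{i=1}^{k-1} [l_{k-1,i} - l_{kj}]) / ∏_{i ≠ j} [l_{ki} - l_{kj}]`. -/
def fCoeff {n : ℕ} (τ : ℂ) (L : Tableau n) (k j : ℕ) : ℂ :=
  (∏ i ∈ Finset.Icc 1 (k - 1), qNum τ (entry L (k - 1) i - entry L k j)) /
    ∏ i ∈ (Finset.Icc 1 k).erase j, qNum τ (entry L k i - entry L k j)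

end QuantumGT

end

noncomputable section

namespace QuantumGT

open Finset

/-! ### Identities between `q`-numbers -/

/-! The formulas define operators on all formal combinations of tableaux, where coefficients with a
vanishing denominator are junk. Every relation is tested only on basis tableaux of `V L`. These are
generic, so the q-numbers that must be invertible are nonzero, and `V L` is invariant because rows
below the top move by integers.

Up to sign, the coefficient of `e_k` or `f_k` is a `rowCoeff`: it involves row `k` and one
neighbour, `k + 1` for `e_k` and `k - 1` for `f_k`. Relations thus become scalar identities about at
most three rows. Distant operators do not see each other. The Cartan relations only record how
`weight` changes under a shift.

For `[e_k, f_k]` the terms that shift two different entries cancel (`rowCoeff_comm_same_row`). The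
surviving diagonal sum is a partial fraction sum over the doubled node set `x_j`, `x_j - 1`,
evaluated by Lagrange interpolation in the variable `q ^ (2p)` (`sum_prod_qNum_div`,
`sum_rowCoeff_commutator`). For `e_k` and `f_{k+1}`, each sees the row of the other, but the two
orders give the same product (`rowCoeff_comm_adjacent_rows`).

In a Serre relation, two shifts of one row at positions `i`, `i'` reach the same tableau in either
order, so it is enough that the coefficients for `(i, i')` and `(i', i)` cancel. For `i = i'` this
is the recurrence `[x + 1] + [x - 1] = (q + q⁻¹) [x]`; for `i ≠ i'` it is `serre_scalar_identity`.
-/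

lemma qPow_add (τ x y : ℂ) : qPow τ (x + y) = qPow τ x * qPow τ y := by
  simp [qPow, mul_add, Complex.exp_add]

lemma qPow_neg (τ x : ℂ) : qPow τ (-x) = (qPow τ x)⁻¹ := by
  simp [qPow, Complex.exp_neg]

lemma qPow_sub (τ x y : ℂ) : qPow τ (x - y) = qPow τ x * (qPow τ y)⁻¹ := by
  rw [sub_eq_add_neg, qPow_add, qPow_neg]

lemma qPow_ne_zero (τ x : ℂ) : qPow τ x ≠ 0 := Complex.exp_ne_zero _

@[simp] lemma qPow_zero (τ : ℂ) : qPow τ 0 = 1 := by simp [qPow]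

lemma qPow_sum {ι : Type*} (τ : ℂ) (s : Finset ι) (f : ι → ℂ) :
    qPow τ (∑ i ∈ s, f i) = ∏ i ∈ s, qPow τ (f i) := by
  simp [qPow, mul_sum, Complex.exp_sum]

lemma qNum_neg (τ x : ℂ) : qNum τ (-x) = -qNum τ x := by
  simp only [qNum, neg_neg]; ring

lemma qNum_sub_comm (τ x y : ℂ) : qNum τ (x - y) = -qNum τ (y - x) := by
  rw [← qNum_neg, neg_sub]

lemma qNum_one {τ : ℂ} (hτ : qPow τ 1 - qPow τ (-1) ≠ 0) : qNum τ 1 = 1 := div_self hτ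

/-- `[x + 1] + [x - 1] = (q + q⁻¹) [x]`. -/
lemma qNum_add_one_add_qNum_sub_one (τ x : ℂ) :
    qNum τ (x + 1) + qNum τ (x - 1) = (qPow τ 1 + qPow τ (-1)) * qNum τ x := by
  simp only [qNum, neg_add, neg_sub, qPow_add, qPow_sub, qPow_neg]
  ring

/-- What remains of the off-diagonal Serre identity once its denominators `[d + 1]`, `[d - 1]` are
cleared and the common factor `q + q⁻¹` is removed. In the variables `q ^ a`, `q ^ d`, `q` it is an
identity of Laurent polynomials. -/
lemma qNum_mul_identity (τ a d : ℂ) :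
    (qNum τ (a + 1) * qNum τ (a + d + 1) + qNum τ a * qNum τ (a + d)) * qNum τ d =
      qNum τ a * qNum τ (a + d + 1) * qNum τ (d - 1) +
        qNum τ (a + d) * qNum τ (a + 1) * qNum τ (d + 1) := by
  simp only [qNum, div_eq_mul_inv]
  generalize (qPow τ 1 - qPow τ (-1))⁻¹ = K
  simp only [neg_add, neg_sub, qPow_add, qPow_sub, qPow_neg]
  have h1 := qPow_ne_zero τ a
  have h2 := qPow_ne_zero τ d
  have h3 := qPow_ne_zero τ 1
  field_simp
  ring

/-! ### Partial fractions for q-numbers -/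

/-- `[c - p]` in terms of `q ^ (2 c)` and `q ^ (2 p)`. -/
lemma qNum_sub_eq (τ c p : ℂ) :
    qNum τ (c - p) = (qPow τ 1 - qPow τ (-1))⁻¹ * (qPow τ c)⁻¹ * (qPow τ p)⁻¹ *
      (qPow τ c ^ 2 - qPow τ p ^ 2) := by
  simp only [qNum, neg_sub, qPow_sub, div_eq_mul_inv]
  generalize (qPow τ 1 - qPow τ (-1))⁻¹ = K
  have h1 := qPow_ne_zero τ c
  have h2 := qPow_ne_zero τ p
  field_simp

/-- Lagrange interpolation at `0` of the difference of two monic polynomials. -/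
lemma sum_prod_sub_div_prod_sub {ι κ F : Type*} [Field F] [DecidableEq ι]
    (s : Finset ι) (t : Finset κ) (P : ι → F) (C : κ → F) (hs : s.card = t.card)
    (hP : Set.InjOn P s) (h0 : ∀ i ∈ s, P i ≠ 0) :
    ∑ i ∈ s, (P i)⁻¹ * ((∏ k ∈ t, (C k - P i)) / ∏ j ∈ s.erase i, (P j - P i)) =
      (∏ k ∈ t, C k) / (∏ i ∈ s, P i) - 1 := by
  classical
  have hPs : ∏ i ∈ s, P i ≠ 0 := prod_ne_zero_iff.2 h0
  -- Both products are monic of the same degree, so `f` has degree below the number of nodes and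
  -- equals its interpolant. At a node only the first product survives.
  set f : Polynomial F := ∏ k ∈ t, (Polynomial.X - Polynomial.C (C k)) -
    ∏ i ∈ s, (Polynomial.X - Polynomial.C (P i)) with hf
  have hmt : (∏ k ∈ t, (Polynomial.X - Polynomial.C (C k))).Monic :=
    Polynomial.monic_prod_of_monic _ _ fun k _ => Polynomial.monic_X_sub_C _
  have hms : (∏ i ∈ s, (Polynomial.X - Polynomial.C (P i))).Monic :=
    Polynomial.monic_prod_of_monic _ _ fun k _ => Polynomial.monic_X_sub_C _
  have hdt : (∏ k ∈ t, (Polynomial.X - Polynomial.C (C k))).degree = (t.card : WithBot ℕ) := by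
    simp [Polynomial.degree_prod]
  have hds : (∏ i ∈ s, (Polynomial.X - Polynomial.C (P i))).degree = (s.card : WithBot ℕ) := by
    simp [Polynomial.degree_prod]
  have hdeg : f.degree < s.card := by
    have := Polynomial.degree_sub_lt_left (hdt.trans (by rw [hds, hs])) hmt.ne_zero
      (by rw [hmt.leadingCoeff, hms.leadingCoeff])
    rwa [hdt, ← hs] at this
  have hint := congrArg (Polynomial.eval 0) (Lagrange.eq_interpolate hP hdeg)
  rw [Lagrange.interpolate_apply, Polynomial.eval_finsetSum] at hint
  have hl : Polynomial.eval 0 f = (-1) ^ s.card * (∏ k ∈ t, C k - ∏ i ∈ s, P i) := by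
    simp only [hf, Polynomial.eval_sub, Polynomial.eval_prod, Polynomial.eval_X,
      Polynomial.eval_C, zero_sub]
    simp only [prod_neg, hs]
    ring
  have hr : ∀ i ∈ s, Polynomial.eval 0
      (Polynomial.C (Polynomial.eval (P i) f) * Lagrange.basis s P i) =
      (-1) ^ s.card * ((∏ i ∈ s, P i) *
        ((P i)⁻¹ * ((∏ k ∈ t, (C k - P i)) / ∏ j ∈ s.erase i, (P j - P i)))) := by
    intro i hi
    have e1 : Polynomial.eval (P i) f = (-1) ^ s.card * ∏ k ∈ t, (C k - P i) := by
      simp only [hf, Polynomial.eval_sub, Polynomial.eval_prod, Polynomial.eval_X,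
        Polynomial.eval_C]
      rw [prod_eq_zero hi (sub_self _), sub_zero, hs, ← prod_neg]
      simp
    have e2 : Polynomial.eval 0 (Lagrange.basis s P i) =
        (∏ i ∈ s, P i) * (P i)⁻¹ / ∏ j ∈ s.erase i, (P j - P i) := by
      rw [Lagrange.basis, Polynomial.eval_prod, ← mul_prod_erase s P hi, mul_comm (P i),
        mul_assoc, mul_inv_cancel₀ (h0 i hi), mul_one, ← prod_div_distrib]
      refine prod_congr rfl fun j hj => ?_
      have : P j - P i ≠ 0 := sub_ne_zero.2 fun h =>
        (ne_of_mem_erase hj) (hP (mem_of_mem_erase hj) hi h)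
      have h' : P i - P j ≠ 0 := by rwa [← neg_sub, neg_ne_zero]
      simp only [Lagrange.basisDivisor, Polynomial.eval_mul, Polynomial.eval_C,
        Polynomial.eval_sub, Polynomial.eval_X]
      field_simp
      ring
    rw [Polynomial.eval_mul, Polynomial.eval_C, e1, e2]
    ring
  rw [hl, sum_congr rfl hr, ← mul_sum, ← mul_sum] at hint
  have hcancel := mul_left_cancel₀ (pow_ne_zero _ (neg_ne_zero.2 one_ne_zero)) hint
  rw [eq_sub_iff_add_eq, eq_div_iff hPs]
  linear_combination -hcancel

/-- `∑_p ∏_c [c - p] / ∏_{p' ≠ p} [p' - p] = [∑ c - ∑ p]`. -/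
lemma sum_prod_qNum_div {ι κ : Type*} [DecidableEq ι] {τ : ℂ}
    (hτ : qPow τ 1 - qPow τ (-1) ≠ 0) (s : Finset ι) (t : Finset κ) (p : ι → ℂ) (c : κ → ℂ)
    (hs : s.card = t.card) (hp : ∀ i ∈ s, ∀ j ∈ s, i ≠ j → qNum τ (p i - p j) ≠ 0) :
    ∑ i ∈ s, (∏ k ∈ t, qNum τ (c k - p i)) / ∏ j ∈ s.erase i, qNum τ (p j - p i) =
      qNum τ (∑ k ∈ t, c k - ∑ i ∈ s, p i) := by
  -- Nodes `q ^ (2 p_i)`: two of them coincide only if `[p_i - p_j] = 0`.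
  have key := sum_prod_sub_div_prod_sub s t (fun i => qPow τ (p i) ^ 2)
    (fun k => qPow τ (c k) ^ 2) hs (fun i hi j hj h => by
      by_contra hij
      exact hp i hi j hj hij (by rw [qNum_sub_eq, sub_eq_zero.2 h, mul_zero]))
    (fun i _ => pow_ne_zero _ (qPow_ne_zero _ _))
  simp only [prod_pow, ← qPow_sum] at key
  rw [qNum_sub_eq]
  set K := (qPow τ 1 - qPow τ (-1))⁻¹ with hK
  have hK0 : K ≠ 0 := inv_ne_zero hτ
  set S := qPow τ (∑ i ∈ s, p i) with hS
  set Z := qPow τ (∑ k ∈ t, c k) with hZ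
  have hS0 : S ≠ 0 := qPow_ne_zero _ _
  have hZ0 : Z ≠ 0 := qPow_ne_zero _ _
  have e : ∀ i ∈ s, (∏ k ∈ t, qNum τ (c k - p i)) / ∏ j ∈ s.erase i, qNum τ (p j - p i) =
      K * Z⁻¹ * S * ((qPow τ (p i) ^ 2)⁻¹ * ((∏ k ∈ t, (qPow τ (c k) ^ 2 - qPow τ (p i) ^ 2)) /
        ∏ j ∈ s.erase i, (qPow τ (p j) ^ 2 - qPow τ (p i) ^ 2))) := by
    intro i hi
    have hpi := qPow_ne_zero τ (p i)
    -- The numerator has `m + 1` factors and the denominator `m`. Exactly one `K` survives, and the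
    -- leftover powers of `q ^ p_i` make up the weight `(P i)⁻¹` of interpolation at `0`.
    obtain ⟨m, hm⟩ : ∃ m, s.card = m + 1 := ⟨s.card - 1, by have := card_pos.2 ⟨i, hi⟩; omega⟩
    have hSi : (∏ j ∈ s.erase i, (qPow τ (p j))⁻¹) = qPow τ (p i) * S⁻¹ := by
      rw [hS, qPow_sum, ← mul_prod_erase s _ hi, prod_inv_distrib]
      field_simp
    simp only [qNum_sub_eq, prod_mul_distrib, prod_const, card_erase_of_mem hi, ← hs, hm,
      Nat.add_sub_cancel, hSi, ← hK, pow_succ]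
    rw [prod_inv_distrib, ← qPow_sum, ← hZ]
    field_simp
  rw [sum_congr rfl e, ← mul_sum, key]
  field_simp

/-! ### Coefficients attached to two rows of a tableau -/

/-- `x` with `ε` added in position `j`. -/
def bump (x : ℕ → ℂ) (j : ℕ) (ε : ℂ) : ℕ → ℂ := Function.update x j (x j + ε)

@[simp] lemma bump_self (x : ℕ → ℂ) (j : ℕ) (ε : ℂ) : bump x j ε j = x j + ε := by simp [bump]

lemma bump_of_ne (x : ℕ → ℂ) {i j : ℕ} (h : i ≠ j) (ε : ℂ) : bump x j ε i = x i := by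
  simp [bump, h]

/-- `∏_i [u_i - z]`. -/
def rowProd (τ : ℂ) (t : Finset ℕ) (u : ℕ → ℂ) (z : ℂ) : ℂ := ∏ i ∈ t, qNum τ (u i - z)

lemma rowProd_erase (τ : ℂ) {t : Finset ℕ} {j : ℕ} (hj : j ∈ t) (u : ℕ → ℂ) (z : ℂ) :
    rowProd τ t u z = qNum τ (u j - z) * rowProd τ (t.erase j) u z :=
  (mul_prod_erase t _ hj).symm

lemma rowProd_bump_of_notMem (τ : ℂ) {t : Finset ℕ} {j : ℕ} (hj : j ∉ t) (u : ℕ → ℂ) (ε z : ℂ) :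
    rowProd τ t (bump u j ε) z = rowProd τ t u z :=
  prod_congr rfl fun i hi => by rw [bump_of_ne u (ne_of_mem_of_not_mem hi hj)]

lemma rowProd_bump (τ : ℂ) {t : Finset ℕ} {j : ℕ} (hj : j ∈ t) (u : ℕ → ℂ) (ε z : ℂ) :
    rowProd τ t (bump u j ε) z = qNum τ (u j + ε - z) * rowProd τ (t.erase j) u z := by
  rw [rowProd_erase τ hj, bump_self, rowProd_bump_of_notMem τ (notMem_erase _ _)]

/-- `∏_i [u_i - x_j] / ∏_{i ≠ j} [x_i - x_j]`. -/
def rowCoeff (τ : ℂ) (s t : Finset ℕ) (x u : ℕ → ℂ) (j : ℕ) : ℂ :=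
  rowProd τ t u (x j) / rowProd τ (s.erase j) x (x j)

lemma rowCoeff_erase (τ : ℂ) {s : Finset ℕ} (t : Finset ℕ) (x u : ℕ → ℂ) {i j : ℕ}
    (hj : j ∈ s) (hij : i ≠ j) :
    rowCoeff τ s t x u i = rowProd τ t u (x i) /
      (qNum τ (x j - x i) * rowProd τ ((s.erase i).erase j) x (x i)) := by
  rw [rowCoeff, rowProd_erase τ (mem_erase.2 ⟨hij.symm, hj⟩) x]

lemma rowCoeff_bump_self (τ : ℂ) (s t : Finset ℕ) (x u : ℕ → ℂ) (j : ℕ) (ε : ℂ) :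
    rowCoeff τ s t (bump x j ε) u j =
      rowProd τ t u (x j + ε) / rowProd τ (s.erase j) x (x j + ε) := by
  rw [rowCoeff, bump_self, rowProd_bump_of_notMem τ (notMem_erase _ _)]

lemma rowCoeff_bump_of_ne (τ : ℂ) {s : Finset ℕ} (t : Finset ℕ) (x u : ℕ → ℂ) {i j : ℕ}
    (hj : j ∈ s) (hij : i ≠ j) (ε : ℂ) :
    rowCoeff τ s t (bump x j ε) u i = rowProd τ t u (x i) /
      (qNum τ (x j + ε - x i) * rowProd τ ((s.erase i).erase j) x (x i)) := by
  rw [rowCoeff, bump_of_ne x hij, rowProd_bump τ (mem_erase.2 ⟨hij.symm, hj⟩) x]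

/-- Opposite shifts of different entries of one row commute. -/
lemma rowCoeff_comm_same_row (τ : ℂ) {s : Finset ℕ} (t r : Finset ℕ) (x u v : ℕ → ℂ) {i j : ℕ}
    (hi : i ∈ s) (hj : j ∈ s) (hij : i ≠ j) (ε : ℂ) :
    rowCoeff τ s t x u i * rowCoeff τ s r (bump x i ε) v j =
      rowCoeff τ s r x v j * rowCoeff τ s t (bump x j (-ε)) u i := by
  rw [rowCoeff_erase τ t x u hj hij, rowCoeff_erase τ r x v hi hij.symm,
    rowCoeff_bump_of_ne τ r x v hi hij.symm, rowCoeff_bump_of_ne τ t x u hj hij,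
    -- The factors linking `i` and `j` agree in both orders up to two sign changes, which cancel.
    qNum_sub_comm τ (x j) (x i), show x j + -ε - x i = -(x i + ε - x j) by ring, qNum_neg]
  simp only [div_mul_div_comm]
  congr 1 <;> ring

/-- Opposite shifts in adjacent rows, both coefficients depending on both rows, commute. -/
lemma rowCoeff_comm_adjacent_rows (τ : ℂ) {s t : Finset ℕ} (x y : ℕ → ℂ) {i j : ℕ}
    (hi : i ∈ s) (hj : j ∈ t) (ε : ℂ) :
    rowCoeff τ s t x y i * rowCoeff τ t s y (bump x i ε) j =
      rowCoeff τ t s y x j * rowCoeff τ s t x (bump y j (-ε)) i := by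
  simp only [rowCoeff, rowProd_bump τ hi, rowProd_bump τ hj, rowProd_erase τ hi x (y j),
    rowProd_erase τ hj y (x i)]
  rw [qNum_sub_comm τ (y j) (x i), show y j + -ε - x i = -(x i + ε - y j) by ring, qNum_neg]
  simp only [div_mul_div_comm]
  congr 1 <;> ring

/-- The diagonal part of the commutator of `e_k` and `f_k`. -/
lemma sum_rowCoeff_commutator {τ : ℂ} (hτ : qPow τ 1 - qPow τ (-1) ≠ 0) {s t r : Finset ℕ}
    (ht : t.card = s.card + 1) (hr : r.card + 1 = s.card) (x u v : ℕ → ℂ)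
    (hx : ∀ i ∈ s, ∀ j ∈ s, i ≠ j → ∀ m : ℤ, qNum τ (x i - x j + m) ≠ 0) :
    ∑ j ∈ s, (rowCoeff τ s t x u j * rowCoeff τ s r (bump x j 1) v j -
        rowCoeff τ s r x v j * rowCoeff τ s t (bump x j (-1)) u j) =
      qNum τ (2 * ∑ i ∈ s, x i - ∑ i ∈ t, u i - ∑ i ∈ r, v i - 1) := by
  have h1 : qNum τ 1 = 1 := qNum_one hτ
  -- The node `x_j` gives the term "`f` after `e`" and the node `x_j - 1` the term "`e` after `f`";
  -- the lower row enters as `v - 1` since `f` then sees `x_j + 1`. The cardinalities match because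
  -- `|t| + |r| = 2 |s|`.
  have key := sum_prod_qNum_div hτ (s.disjSum s) (t.disjSum r)
    (Sum.elim x fun i => x i - 1) (Sum.elim u fun i => v i - 1)
    (by rw [card_disjSum, card_disjSum]; omega) (by
      -- Nodes of opposite kinds may carry the same index; their difference is then `±1`, and `[±1]
      -- = ±1`.
      have aux : ∀ i ∈ s, ∀ j ∈ s, (m : ℤ) → (m = 1 ∨ m = -1) → qNum τ (x i - x j + m) ≠ 0 := by
        intro i hi j hj m hm
        rcases eq_or_ne i j with rfl | h
        · rcases hm with rfl | rfl <;> simp [qNum_neg, h1]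
        · exact hx i hi j hj h m
      rintro (i | i) hi (j | j) hj hij <;>
        simp only [inl_mem_disjSum, inr_mem_disjSum] at hi hj <;>
        simp only [Sum.elim_inl, Sum.elim_inr]
      · simpa using hx i hi j hj (fun h => hij (h ▸ rfl)) 0
      · convert aux i hi j hj 1 (Or.inl rfl) using 2; push_cast; ring
      · convert aux i hi j hj (-1) (Or.inr rfl) using 2; push_cast; ring
      · convert hx i hi j hj (fun h => hij (h ▸ rfl)) 0 using 2; push_cast; ring)
  have el : ∀ j, (s.disjSum s).erase (Sum.inl j) = (s.erase j).disjSum s := by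
    intro j; ext (a | a) <;> simp
  have er : ∀ j, (s.disjSum s).erase (Sum.inr j) = s.disjSum (s.erase j) := by
    intro j; ext (a | a) <;> simp
  rw [sum_disjSum] at key
  simp only [el, er, prod_disjSum, sum_disjSum, Sum.elim_inl, Sum.elim_inr, sum_sub_distrib,
    sum_const, nsmul_eq_mul, mul_one] at key
  -- The `-1` in the conclusion is `|r| - |s|`, the imbalance between lowered `v`'s and lowered
  -- nodes.
  have hrs : (r.card : ℂ) = s.card - 1 := by rw [← hr]; push_cast; ring
  rw [show 2 * ∑ i ∈ s, x i - ∑ i ∈ t, u i - ∑ i ∈ r, v i - 1 =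
    -(∑ k ∈ t, u k + (∑ k ∈ r, v k - r.card) - (∑ k ∈ s, x k + (∑ k ∈ s, x k - s.card))) by
      rw [hrs]; ring, qNum_neg, ← key, ← sum_add_distrib, ← sum_neg_distrib]
  refine sum_congr rfl fun j hj => ?_
  rw [rowCoeff_bump_self, rowCoeff_bump_self, ← mul_prod_erase s _ hj, ← mul_prod_erase s _ hj,
    show x j - 1 - x j = -1 by ring, show x j - (x j - 1) = 1 by ring, qNum_neg, h1]
  have e1 : ∀ (t : Finset ℕ) (w : ℕ → ℂ), ∏ i ∈ t, qNum τ (w i - 1 - x j) =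
      rowProd τ t w (x j + 1) := fun t w => prod_congr rfl fun i _ => congrArg _ (by ring)
  have e2 : ∀ (t : Finset ℕ) (w : ℕ → ℂ), ∏ i ∈ t, qNum τ (w i - (x j - 1)) =
      rowProd τ t w (x j + -1) := fun t w => prod_congr rfl fun i _ => congrArg _ (by ring)
  have e3 : ∀ (t : Finset ℕ) (w : ℕ → ℂ), ∏ i ∈ t, qNum τ (w i - 1 - (x j - 1)) =
      rowProd τ t w (x j) := fun t w => prod_congr rfl fun i _ => congrArg _ (by ring)
  have e4 : ∀ (t : Finset ℕ) (w : ℕ → ℂ), ∏ i ∈ t, qNum τ (w i - x j) =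
      rowProd τ t w (x j) := fun t w => rfl
  simp only [e3]
  simp only [e1, e2, e4, rowCoeff, div_mul_div_comm, neg_mul, one_mul, mul_neg, div_neg]
  ring

/-! ### Serre identities for row coefficients -/

/-- The scalar identity behind the Serre relations. -/
lemma serre_scalar_identity {τ ε : ℂ} (hε : ε = 1 ∨ ε = -1) (a d : ℂ) (h1 : qNum τ (d + ε) ≠ 0)
    (h2 : qNum τ (d - ε) ≠ 0) :
    (qNum τ (a + ε) * qNum τ (a + d + ε) -
        (qPow τ 1 + qPow τ (-1)) * (qNum τ a * qNum τ (a + d + ε)) + qNum τ a * qNum τ (a + d)) /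
          qNum τ (d + ε) +
      (qNum τ (a + d + ε) * qNum τ (a + ε) -
        (qPow τ 1 + qPow τ (-1)) * (qNum τ (a + d) * qNum τ (a + ε)) +
          qNum τ (a + d) * qNum τ a) / qNum τ (d - ε) = 0 := by
  rw [div_add_div _ _ h1 h2, div_eq_zero_iff]
  left
  rcases hε with rfl | rfl
  · have e1 := qNum_add_one_add_qNum_sub_one τ d
    have e2 := qNum_mul_identity τ a d
    linear_combination (qNum τ (a + 1) * qNum τ (a + d + 1) + qNum τ a * qNum τ (a + d)) * e1 +
      (qPow τ 1 + qPow τ (-1)) * e2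
  · have e1 := qNum_add_one_add_qNum_sub_one τ d
    -- Oddness of `[x]` turns the case `ε = -1` into `ε = 1` at `(-a, -d)`.
    have e2 := qNum_mul_identity τ (-a) (-d)
    simp only [show -a + 1 = -(a + -1) by ring, show -(a + d) + 1 = -(a + d + -1) by ring,
      show -a + -d = -(a + d) by ring, show -d - 1 = -(d + 1) by ring,
      show -d + 1 = -(d + -1) by ring, qNum_neg] at e2
    rw [sub_neg_eq_add]
    rw [sub_eq_add_neg] at e1
    linear_combination (qNum τ (a + -1) * qNum τ (a + d + -1) + qNum τ a * qNum τ (a + d)) * e1 -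
      (qPow τ 1 + qPow τ (-1)) * e2

/-- Changing the sign of `ε` only swaps the outer terms. This settles the Serre terms that shift one
entry twice. -/
lemma qNum_add_add_qNum_sub {ε : ℂ} (hε : ε = 1 ∨ ε = -1) (τ x : ℂ) :
    qNum τ (x + ε) - (qPow τ 1 + qPow τ (-1)) * qNum τ x + qNum τ (x - ε) = 0 := by
  have := qNum_add_one_add_qNum_sub_one τ x
  rcases hε with rfl | rfl
  · linear_combination this
  · rw [sub_neg_eq_add, ← sub_eq_add_neg]; linear_combination this

lemma qNum_shift_ne_zero {τ ε : ℂ} (hε : ε = 1 ∨ ε = -1) {s : Finset ℕ} {x : ℕ → ℂ}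
    (hx : ∀ i ∈ s, ∀ j ∈ s, i ≠ j → ∀ m : ℤ, qNum τ (x i - x j + m) ≠ 0) {i j : ℕ}
    (hi : i ∈ s) (hj : j ∈ s) (hij : i ≠ j) :
    qNum τ (x i - x j + ε) ≠ 0 ∧ qNum τ (x i - x j - ε) ≠ 0 := by
  rcases hε with rfl | rfl
  · exact ⟨by simpa using hx i hi j hj hij 1, by simpa [sub_eq_add_neg] using hx i hi j hj hij (-1)⟩
  · exact ⟨by simpa using hx i hi j hj hij (-1), by simpa using hx i hi j hj hij 1⟩

/-- The product of the coefficients for two successive shifts of different entries of a row. -/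
lemma rowCoeff_mul_rowCoeff_bump (τ : ℂ) {s : Finset ℕ} (t : Finset ℕ) (x u v : ℕ → ℂ) {i j : ℕ}
    (hi : i ∈ s) (hj : j ∈ s) (hij : i ≠ j) (ε : ℂ) :
    rowCoeff τ s t x u i * rowCoeff τ s t (bump x i ε) v j =
      -(rowProd τ t u (x i) * rowProd τ t v (x j)) / qNum τ (x i - x j + ε) *
        (qNum τ (x i - x j) * (rowProd τ ((s.erase i).erase j) x (x i) *
          rowProd τ ((s.erase i).erase j) x (x j)))⁻¹ := by
  rw [rowCoeff_erase τ t x u hj hij, rowCoeff_bump_of_ne τ t x v hi hij.symm,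
    qNum_sub_comm τ (x j) (x i), erase_right_comm, show x i + ε - x j = x i - x j + ε by ring]
  simp only [div_eq_mul_inv, mul_inv, neg_mul, inv_neg, mul_neg]
  ring

/-- Serre relation, when the coefficients of the doubled operator depend on the other row. -/
lemma serre_rowCoeff_first {τ ε : ℂ} (hε : ε = 1 ∨ ε = -1) {s t : Finset ℕ} {x : ℕ → ℂ}
    (hx : ∀ i ∈ s, ∀ j ∈ s, i ≠ j → ∀ m : ℤ, qNum τ (x i - x j + m) ≠ 0) (y : ℕ → ℂ)
    {T : ℕ → ℕ → ℂ} {j : ℕ} (hj : j ∈ t)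
    (hT : ∀ i i', T i i' =
      rowCoeff τ s t x (bump y j ε) i * rowCoeff τ s t (bump x i ε) (bump y j ε) i' -
        (qPow τ 1 + qPow τ (-1)) *
          (rowCoeff τ s t x y i * rowCoeff τ s t (bump x i ε) (bump y j ε) i') +
        rowCoeff τ s t x y i * rowCoeff τ s t (bump x i ε) y i')
    {i i' : ℕ} (hi : i ∈ s) (hi' : i' ∈ s) : T i i' + T i' i = 0 := by
  rcases eq_or_ne i i' with rfl | h
  · suffices T i i = 0 by rw [this, add_zero]
    rw [hT]
    simp only [rowCoeff_bump_self]
    simp only [rowCoeff, rowProd_bump τ hj, rowProd_erase τ hj y]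
    have := qNum_add_add_qNum_sub hε τ (y j - x i)
    rw [show y j + ε - (x i + ε) = y j - x i by ring, show y j + ε - x i = y j - x i + ε by ring,
      show y j - (x i + ε) = y j - x i - ε by ring]
    simp only [div_eq_mul_inv]
    linear_combination (qNum τ (y j - x i) * rowProd τ (t.erase j) y (x i) *
      (rowProd τ (s.erase i) x (x i))⁻¹ * rowProd τ (t.erase j) y (x i + ε) *
      (rowProd τ (s.erase i) x (x i + ε))⁻¹) * this
  · obtain ⟨h1, h2⟩ := qNum_shift_ne_zero hε hx hi hi' h
    rw [hT, hT]
    simp only [rowCoeff_mul_rowCoeff_bump τ t x _ _ hi hi' h,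
      rowCoeff_mul_rowCoeff_bump τ t x _ _ hi' hi h.symm, rowProd_bump τ hj, rowProd_erase τ hj y]
    have := serre_scalar_identity hε (y j - x i) (x i - x i') h1 h2
    rw [qNum_sub_comm τ (x i') (x i), show x i' - x i + ε = -(x i - x i' - ε) by ring, qNum_neg,
      erase_right_comm (a := i')]
    rw [show y j - x i + (x i - x i') = y j - x i' by ring] at this
    rw [show y j + ε - x i = y j - x i + ε by ring, show y j + ε - x i' = y j - x i' + ε by ring]
    simp only [div_eq_mul_inv, inv_neg, neg_mul, mul_neg] at this ⊢
    linear_combination (-rowProd τ (t.erase j) y (x i) * rowProd τ (t.erase j) y (x i') *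
      (qNum τ (x i - x i') * (rowProd τ ((s.erase i).erase i') x (x i) *
          rowProd τ ((s.erase i).erase i') x (x i')))⁻¹) * this

/-- Serre relation, when the coefficients of the other operator depend on the row of the
doubled one. -/
lemma serre_rowCoeff_second {τ ε : ℂ} (hε : ε = 1 ∨ ε = -1) {s t : Finset ℕ} {y : ℕ → ℂ}
    (hy : ∀ i ∈ s, ∀ j ∈ s, i ≠ j → ∀ m : ℤ, qNum τ (y i - y j + m) ≠ 0) (w : ℕ → ℂ) (z : ℂ)
    {T : ℕ → ℕ → ℂ}
    (hT : ∀ i i', T i i' = rowCoeff τ s t y w i * rowCoeff τ s t (bump y i ε) w i' *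
      (rowProd τ s y z - (qPow τ 1 + qPow τ (-1)) * rowProd τ s (bump y i ε) z +
        rowProd τ s (bump (bump y i ε) i' ε) z))
    {i i' : ℕ} (hi : i ∈ s) (hi' : i' ∈ s) : T i i' + T i' i = 0 := by
  rcases eq_or_ne i i' with rfl | h
  · suffices T i i = 0 by rw [this, add_zero]
    -- The row product is met with entry `i` moved by `0`, `ε` and `2ε`; the recurrence is centred
    -- at the middle one.
    have := qNum_add_add_qNum_sub hε τ (y i + ε - z)
    rw [hT, rowProd_bump τ hi, rowProd_bump τ hi, bump_self,
      rowProd_bump_of_notMem τ (notMem_erase _ _), rowProd_erase τ hi]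
    rw [show y i + ε - z + ε = y i + ε + ε - z by ring,
      show y i + ε - z - ε = y i - z by ring] at this
    linear_combination (rowCoeff τ s t y w i * rowCoeff τ s t (bump y i ε) w i *
      rowProd τ (s.erase i) y z) * this
  · obtain ⟨h1, h2⟩ := qNum_shift_ne_zero hε hy hi hi' h
    have hm : i ∈ s.erase i' := mem_erase.2 ⟨h, hi⟩
    have hm' : i' ∈ s.erase i := mem_erase.2 ⟨h.symm, hi'⟩
    rw [hT, hT]
    simp only [rowCoeff_mul_rowCoeff_bump τ t y _ _ hi hi' h,
      rowCoeff_mul_rowCoeff_bump τ t y _ _ hi' hi h.symm]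
    rw [rowProd_bump τ hi (bump y i' ε), rowProd_bump τ hi' (bump y i ε), bump_of_ne y h,
      bump_of_ne y h.symm, rowProd_bump τ hi y, rowProd_bump τ hi' y, rowProd_bump τ hm,
      rowProd_bump τ hm', rowProd_erase τ hi y, rowProd_erase τ hm y z, rowProd_erase τ hm' y z,
      qNum_sub_comm τ (y i') (y i), show y i' - y i + ε = -(y i - y i' - ε) by ring, qNum_neg,
      erase_right_comm (a := i')]
    have := serre_scalar_identity hε (y i' - z) (y i - y i') h1 h2
    rw [show y i' - z + (y i - y i') = y i - z by ring] at this
    rw [show y i + ε - z = y i - z + ε by ring, show y i' + ε - z = y i' - z + ε by ring]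
    simp only [div_eq_mul_inv, inv_neg, neg_mul, mul_neg] at this ⊢
    linear_combination (-rowProd τ t w (y i) * rowProd τ t w (y i') *
      rowProd τ ((s.erase i).erase i') y z *
      (qNum τ (y i - y i') * (rowProd τ ((s.erase i).erase i') y (y i) *
          rowProd τ ((s.erase i).erase i') y (y i')))⁻¹) * this

/-! ### Shifting tableaux -/

lemma qPow_one_sub_ne_zero {τ : ℂ} (hq : ∀ m : ℕ, 0 < m → Complex.exp τ ^ m ≠ 1) :
    qPow τ 1 - qPow τ (-1) ≠ 0 := by
  intro h
  have h0 := qPow_ne_zero τ 1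
  rw [qPow_neg, sub_eq_zero] at h
  apply hq 2 two_pos
  rw [show Complex.exp τ = qPow τ 1 by simp [qPow], sq]
  nth_rewrite 2 [h]
  exact mul_inv_cancel₀ h0

/-- `[x] = 0` exactly when `q ^ (2x) = 1`, that is, when `x` lies in `1(q)/2`, so genericity
excludes this for every integral translate. -/
lemma IsGeneric.qNum_ne_zero {n : ℕ} {τ : ℂ} (hτ : qPow τ 1 - qPow τ (-1) ≠ 0) {R : Tableau n}
    (hR : IsGeneric τ R) {k : ℕ} (hk : k < n) :
    ∀ i ∈ Icc 1 k, ∀ j ∈ Icc 1 k, i ≠ j → ∀ m : ℤ,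
      qNum τ (entry R k i - entry R k j + m) ≠ 0 := by
  intro i hi j hj hij m h
  rw [mem_Icc] at hi hj
  refine hR k i j hk hi.1 hi.2 hj.1 hj.2 hij
    ⟨-m, 2 * (entry R k i - entry R k j + m), ?_, by push_cast; ring⟩
  rw [qNum, div_eq_zero_iff, or_iff_left hτ, sub_eq_zero, qPow_neg] at h
  rw [two_mul, qPow_add]
  nth_rewrite 2 [h]
  exact mul_inv_cancel₀ (qPow_ne_zero _ _)

lemma entry_add_smul_delta {n k j : ℕ} (R : Tableau n) (ε : ℂ) (hk : k ≤ n) (hj : j ∈ Icc 1 k) :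
    entry (R + ε • delta n k j) k = bump (entry R k) j ε := by
  rw [mem_Icc] at hj
  funext i
  rcases eq_or_ne i j with rfl | h
  · rw [bump_self]; simp [entry, delta, hj, hk]
  · rw [bump_of_ne _ h]
    simp [entry, delta, h]

lemma entry_add_smul_delta_of_ne {n k k' j : ℕ} (R : Tableau n) (ε : ℂ) (h : k' ≠ k) :
    entry (R + ε • delta n k j) k' = entry R k' := by
  funext i
  simp [entry, delta, h]

/-- The top row is frozen, hence `k < n`. -/
lemma isShift_add_smul_delta {n k j : ℕ} {L R : Tableau n} (hR : IsShift L R) {ε : ℂ}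
    (hε : ε = 1 ∨ ε = -1) (hk : k < n) : IsShift L (R + ε • delta n k j) := by
  obtain ⟨z, hz, rfl⟩ := hR
  obtain ⟨e, rfl⟩ : ∃ e : ℤ, ε = e := by
    rcases hε with rfl | rfl
    exacts [⟨1, by simp⟩, ⟨-1, by simp⟩]
  refine ⟨fun p => z p + if p.1 = (k, j) then e else 0, fun p hp => ?_, ?_⟩
  · have : p.1 ≠ (k, j) := fun h => by rw [h] at hp; exact hk.ne hp
    simp [hz p hp, this]
  · funext p
    simp only [Pi.add_apply, Pi.smul_apply, delta, smul_eq_mul]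
    split_ifs <;> push_cast <;> ring

lemma sum_bump {s : Finset ℕ} {j : ℕ} (hj : j ∈ s) (x : ℕ → ℂ) (ε : ℂ) :
    ∑ i ∈ s, bump x j ε i = ∑ i ∈ s, x i + ε := by
  rw [← add_sum_erase s _ hj, ← add_sum_erase s x hj, bump_self,
    sum_congr rfl fun i hi => bump_of_ne x (ne_of_mem_erase hi) ε]
  ring

/-- The exponent `∑ h_k a_k` by which `q ^ h` acts. -/
def weight {n : ℕ} (h : Cartan n) (R : Tableau n) : ℂ := ∑ k : Fin n, h k * aCoeff R (k + 1)

lemma aCoeff_add_smul_delta {n k j : ℕ} (R : Tableau n) (ε : ℂ) (hk : k ≤ n) (hj : j ∈ Icc 1 k)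
    (m : ℕ) : aCoeff (R + ε • delta n k j) (m + 1) =
      aCoeff R (m + 1) + ε * ((if m + 1 = k then 1 else 0) - (if m = k then 1 else 0)) := by
  simp only [aCoeff, Nat.add_sub_cancel]
  by_cases h1 : m + 1 = k
  · subst h1
    rw [entry_add_smul_delta R ε hk hj, entry_add_smul_delta_of_ne R ε (by omega : m ≠ m + 1),
      sum_bump hj]
    simp; ring
  · by_cases h2 : m = k
    · subst h2
      rw [entry_add_smul_delta R ε hk hj, entry_add_smul_delta_of_ne R ε h1, sum_bump hj]
      simp; ring
    · rw [entry_add_smul_delta_of_ne R ε h1, entry_add_smul_delta_of_ne R ε h2]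
      simp [h1, h2]

lemma weight_add_smul_delta {n j : ℕ} (h : Cartan n) (R : Tableau n) (ε : ℂ) (i : Fin (n - 1))
    (hj : j ∈ Icc 1 (i + 1 : ℕ)) :
    weight h (R + ε • delta n (i + 1) j) = weight h R + ε * rootPairing h i := by
  have hin := i.2
  have e1 : ∀ k : Fin n, ((k : ℕ) + 1 = (i : ℕ) + 1) = (k = lo i) := by
    intro k; simp [lo, Fin.ext_iff]
  have e2 : ∀ k : Fin n, ((k : ℕ) = (i : ℕ) + 1) = (k = hi i) := by
    intro k; simp [hi, Fin.ext_iff]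
  simp only [weight, aCoeff_add_smul_delta R ε (by omega : (i : ℕ) + 1 ≤ n) hj, mul_add,
    sum_add_distrib, e1, e2, rootPairing]
  congr 1
  simp only [mul_sub, sum_sub_distrib, mul_ite, mul_one, mul_zero, sum_ite_eq', mem_univ, if_true]
  ring

lemma weight_add {n : ℕ} (h h' : Cartan n) (R : Tableau n) :
    weight (h + h') R = weight h R + weight h' R := by
  simp [weight, add_mul, sum_add_distrib]

lemma weight_neg {n : ℕ} (h : Cartan n) (R : Tableau n) : weight (-h) R = -weight h R := by
  simp [weight]

lemma weight_zero {n : ℕ} (R : Tableau n) : weight 0 R = 0 := by simp [weight]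

lemma weight_eps {n : ℕ} (k : Fin n) (R : Tableau n) : weight (eps k) R = aCoeff R (k + 1) := by
  simp [weight, eps, Pi.single_apply]

/-- The final `-1` is the difference `k - (k + 1)` of the constants in `a_k` and `a_{k+1}`; it
matches the one in `sum_rowCoeff_commutator`. -/
lemma weight_simpleRoot {n : ℕ} (i : Fin (n - 1)) (R : Tableau n) :
    weight (simpleRoot i) R = 2 * ∑ l ∈ Icc 1 (i + 1 : ℕ), entry R (i + 1) l -
      ∑ l ∈ Icc 1 (i + 2 : ℕ), entry R (i + 2) l - ∑ l ∈ Icc 1 (i : ℕ), entry R i l - 1 := by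
  rw [simpleRoot, sub_eq_add_neg, weight_add, weight_neg, weight_eps, weight_eps]
  simp only [aCoeff, lo, hi, Nat.add_sub_cancel]
  push_cast
  ring

/-! ### Operators on formal combinations of tableaux -/

/-- The operator sending `R` to `∑_j c_j(R) (R + ε δ^{kj})`. -/
def ladder {n : ℕ} (k : ℕ) (ε : ℂ) (c : Tableau n → ℕ → ℂ) : Module.End ℂ (Tableau n →₀ ℂ) :=
  Finsupp.linearCombination ℂ fun R =>
    ∑ j ∈ Icc 1 k, Finsupp.single (R + ε • delta n k j) (c R j)

/-- The operator sending `R` to `w(R) R`. -/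
def diagonal {n : ℕ} (w : Tableau n → ℂ) : Module.End ℂ (Tableau n →₀ ℂ) :=
  Finsupp.linearCombination ℂ fun R => Finsupp.single R (w R)

lemma ladder_single {n : ℕ} (k : ℕ) (ε : ℂ) (c : Tableau n → ℕ → ℂ) (R : Tableau n) (b : ℂ) :
    ladder k ε c (Finsupp.single R b) =
      ∑ j ∈ Icc 1 k, Finsupp.single (R + ε • delta n k j) (b * c R j) := by
  simp [ladder, smul_sum]

lemma diagonal_single {n : ℕ} (w : Tableau n → ℂ) (R : Tableau n) (b : ℂ) :
    diagonal w (Finsupp.single R b) = Finsupp.single R (b * w R) := by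
  simp [diagonal]

lemma ladder_comm {n k l : ℕ} {ε ε' : ℂ} {c c' : Tableau n → ℕ → ℂ} (R : Tableau n)
    (h : ∀ i ∈ Icc 1 k, ∀ j ∈ Icc 1 l,
      c R i * c' (R + ε • delta n k i) j = c' R j * c (R + ε' • delta n l j) i) :
    ladder l ε' c' (ladder k ε c (Finsupp.single R 1)) =
      ladder k ε c (ladder l ε' c' (Finsupp.single R 1)) := by
  simp only [ladder_single, map_sum, one_mul]
  rw [sum_comm]
  refine sum_congr rfl fun j hj => sum_congr rfl fun i hi => ?_
  rw [h i hi j hj, add_right_comm]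

/-- Opposite shifts at different positions cancel by `h`; at equal positions they return to `R`. -/
lemma ladder_commutator {n k : ℕ} {ε : ℂ} {c c' : Tableau n → ℕ → ℂ} (R : Tableau n)
    (h : ∀ i ∈ Icc 1 k, ∀ j ∈ Icc 1 k, i ≠ j →
      c R i * c' (R + ε • delta n k i) j = c' R j * c (R + -ε • delta n k j) i) :
    ladder k ε c (ladder k (-ε) c' (Finsupp.single R 1)) -
        ladder k (-ε) c' (ladder k ε c (Finsupp.single R 1)) =
      Finsupp.single R (∑ j ∈ Icc 1 k, (c' R j * c (R + -ε • delta n k j) j -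
        c R j * c' (R + ε • delta n k j) j)) := by
  simp only [ladder_single, map_sum, one_mul]
  rw [sum_comm, ← sum_sub_distrib, Finsupp.single_finsetSum]
  refine sum_congr rfl fun i hi => ?_
  rw [← sum_sub_distrib, sum_eq_single_of_mem i hi]
  · rw [neg_smul, neg_add_cancel_right, add_neg_cancel_right, Finsupp.single_sub]
  · intro j hj hji
    rw [h i hi j hj hji.symm, add_right_comm, sub_self]

/-- `T j i i'` collects the coefficients of all three words at one target tableau, which is
symmetric in `i` and `i'`. Only the symmetrization of `T` has to vanish. -/
lemma ladder_serre {n k l : ℕ} {ε s : ℂ} {c c' : Tableau n → ℕ → ℂ} (R : Tableau n)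
    {T : ℕ → ℕ → ℕ → ℂ}
    (hT : ∀ i ∈ Icc 1 k, ∀ i' ∈ Icc 1 k, ∀ j ∈ Icc 1 l, T j i i' =
      c' R j * c (R + ε • delta n l j) i * c (R + ε • delta n l j + ε • delta n k i) i' -
      s * (c R i * c' (R + ε • delta n k i) j *
        c (R + ε • delta n k i + ε • delta n l j) i') +
      c R i * c (R + ε • delta n k i) i' *
        c' (R + ε • delta n k i + ε • delta n k i') j)
    (h : ∀ i ∈ Icc 1 k, ∀ i' ∈ Icc 1 k, ∀ j ∈ Icc 1 l, T j i i' + T j i' i = 0) :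
    ladder k ε c (ladder k ε c (ladder l ε c' (Finsupp.single R 1))) -
        s • ladder k ε c (ladder l ε c' (ladder k ε c (Finsupp.single R 1))) +
      ladder l ε c' (ladder k ε c (ladder k ε c (Finsupp.single R 1))) = 0 := by
  set S : ℕ → ℕ → ℕ → Tableau n := fun j i i' =>
    R + ε • delta n l j + ε • delta n k i + ε • delta n k i' with hS
  have key : ladder k ε c (ladder k ε c (ladder l ε c' (Finsupp.single R 1))) -
        s • ladder k ε c (ladder l ε c' (ladder k ε c (Finsupp.single R 1))) +
      ladder l ε c' (ladder k ε c (ladder k ε c (Finsupp.single R 1))) =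
      ∑ j ∈ Icc 1 l, ∑ i ∈ Icc 1 k, ∑ i' ∈ Icc 1 k, Finsupp.single (S j i i') (T j i i') := by
    have e1 : ladder k ε c (ladder l ε c' (ladder k ε c (Finsupp.single R 1))) =
        ∑ j ∈ Icc 1 l, ∑ i ∈ Icc 1 k, ∑ i' ∈ Icc 1 k, Finsupp.single (S j i i')
          (c R i * c' (R + ε • delta n k i) j *
            c (R + ε • delta n k i + ε • delta n l j) i') := by
      simp only [ladder_single, map_sum, one_mul]
      rw [sum_comm]
      refine sum_congr rfl fun j _ => sum_congr rfl fun i _ => sum_congr rfl fun i' _ => ?_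
      rw [hS, add_right_comm R]
    have e2 : ladder l ε c' (ladder k ε c (ladder k ε c (Finsupp.single R 1))) =
        ∑ j ∈ Icc 1 l, ∑ i ∈ Icc 1 k, ∑ i' ∈ Icc 1 k, Finsupp.single (S j i i')
          (c R i * c (R + ε • delta n k i) i' *
            c' (R + ε • delta n k i + ε • delta n k i') j) := by
      simp only [ladder_single, map_sum, one_mul]
      rw [sum_congr rfl fun i _ => sum_comm, sum_comm]
      refine sum_congr rfl fun j _ => sum_congr rfl fun i _ => sum_congr rfl fun i' _ => ?_
      rw [show S j i i' = R + ε • delta n k i + ε • delta n k i' + ε • delta n l j by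
        simp only [hS]; abel]
    rw [e1, e2]
    simp only [ladder_single, map_sum, one_mul, smul_sum, ← sum_sub_distrib, ← sum_add_distrib]
    refine sum_congr rfl fun j hj => sum_congr rfl fun i hi => sum_congr rfl fun i' hi' => ?_
    rw [Finsupp.smul_single, ← Finsupp.single_sub, ← Finsupp.single_add, hT i hi i' hi' j hj,
      smul_eq_mul]
  rw [key]
  refine sum_eq_zero fun j hj => ?_
  -- The double sum is added to its transpose, and the factor `2` is then removed.
  have h2 : ∑ i ∈ Icc 1 k, ∑ i' ∈ Icc 1 k, Finsupp.single (S j i i') (T j i i') +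
      ∑ i ∈ Icc 1 k, ∑ i' ∈ Icc 1 k, Finsupp.single (S j i i') (T j i i') = 0 := by
    nth_rewrite 2 [sum_comm]
    rw [← sum_add_distrib]
    refine sum_eq_zero fun i hi => ?_
    rw [← sum_add_distrib]
    refine sum_eq_zero fun i' hi' => ?_
    rw [show S j i' i = S j i i' from add_right_comm _ _ _, ← Finsupp.single_add,
      h i hi i' hi' j hj, Finsupp.single_zero]
  rw [← two_smul ℂ] at h2
  exact (smul_eq_zero.1 h2).resolve_left two_ne_zero

/-- Serre relation between the operators of two neighbouring rows, the doubled operator being the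
one whose coefficients depend on both rows. -/
lemma ladder_serre_first {n k l m : ℕ} {τ ε σ : ℂ} (hε : ε = 1 ∨ ε = -1) (hk : k ≤ n) (hl : l ≤ n)
    (hkl : k ≠ l) (hkm : k ≠ m) {R : Tableau n} {c c' : Tableau n → ℕ → ℂ}
    (hc : ∀ R j, c R j = σ * rowCoeff τ (Icc 1 k) (Icc 1 l) (entry R k) (entry R l) j)
    (hc' : ∀ R j, c' R j = σ * rowCoeff τ (Icc 1 l) (Icc 1 m) (entry R l) (entry R m) j)
    (hR : ∀ i ∈ Icc 1 k, ∀ j ∈ Icc 1 k, i ≠ j → ∀ m : ℤ,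
      qNum τ (entry R k i - entry R k j + m) ≠ 0) :
    ladder k ε c (ladder k ε c (ladder l ε c' (Finsupp.single R 1))) -
        (qPow τ 1 + qPow τ (-1)) •
          ladder k ε c (ladder l ε c' (ladder k ε c (Finsupp.single R 1))) +
      ladder l ε c' (ladder k ε c (ladder k ε c (Finsupp.single R 1))) = 0 := by
  set x := entry R k with hx
  set y := entry R l with hy
  refine ladder_serre R (T := fun j i i' =>
    σ ^ 3 * rowCoeff τ (Icc 1 l) (Icc 1 m) y (entry R m) j *
    (rowCoeff τ (Icc 1 k) (Icc 1 l) x (bump y j ε) i *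
        rowCoeff τ (Icc 1 k) (Icc 1 l) (bump x i ε) (bump y j ε) i' -
      (qPow τ 1 + qPow τ (-1)) * (rowCoeff τ (Icc 1 k) (Icc 1 l) x y i *
        rowCoeff τ (Icc 1 k) (Icc 1 l) (bump x i ε) (bump y j ε) i') +
      rowCoeff τ (Icc 1 k) (Icc 1 l) x y i *
        rowCoeff τ (Icc 1 k) (Icc 1 l) (bump x i ε) y i')) ?_ ?_
  · intro i hi i' hi' j hj
    simp only [hc, hc', entry_add_smul_delta _ ε hk hi, entry_add_smul_delta _ ε hl hj,
      entry_add_smul_delta_of_ne _ ε hkl, entry_add_smul_delta_of_ne _ ε hkl.symm,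
      entry_add_smul_delta_of_ne _ ε hkm.symm, ← hx, ← hy]
    ring
  · intro i hi i' hi' j hj
    have := serre_rowCoeff_first hε hR y hj (fun _ _ => rfl) hi hi'
    linear_combination σ ^ 3 * rowCoeff τ (Icc 1 l) (Icc 1 m) y (entry R m) j * this

/-- Serre relation between the operators of two neighbouring rows, the doubled operator being the
one whose coefficients do not depend on the other row. -/
lemma ladder_serre_second {n k l m : ℕ} {τ ε σ : ℂ} (hε : ε = 1 ∨ ε = -1) (hl : l ≤ n)
    (hkl : k ≠ l) (hkm : k ≠ m) (hlm : l ≠ m) {R : Tableau n} {c c' : Tableau n → ℕ → ℂ}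
    (hc : ∀ R j, c R j = σ * rowCoeff τ (Icc 1 k) (Icc 1 l) (entry R k) (entry R l) j)
    (hc' : ∀ R j, c' R j = σ * rowCoeff τ (Icc 1 l) (Icc 1 m) (entry R l) (entry R m) j)
    (hR : ∀ i ∈ Icc 1 l, ∀ j ∈ Icc 1 l, i ≠ j → ∀ m : ℤ,
      qNum τ (entry R l i - entry R l j + m) ≠ 0) :
    ladder l ε c' (ladder l ε c' (ladder k ε c (Finsupp.single R 1))) -
        (qPow τ 1 + qPow τ (-1)) •
          ladder l ε c' (ladder k ε c (ladder l ε c' (Finsupp.single R 1))) +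
      ladder k ε c (ladder l ε c' (ladder l ε c' (Finsupp.single R 1))) = 0 := by
  set x := entry R k with hx
  set y := entry R l with hy
  set w := entry R m with hw
  refine ladder_serre R (T := fun j i i' =>
    σ ^ 3 * (rowProd τ ((Icc 1 k).erase j) x (x j))⁻¹ *
    (rowCoeff τ (Icc 1 l) (Icc 1 m) y w i * rowCoeff τ (Icc 1 l) (Icc 1 m) (bump y i ε) w i' *
      (rowProd τ (Icc 1 l) y (x j) -
        (qPow τ 1 + qPow τ (-1)) * rowProd τ (Icc 1 l) (bump y i ε) (x j) +
        rowProd τ (Icc 1 l) (bump (bump y i ε) i' ε) (x j)))) ?_ ?_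
  · intro i hi i' hi' j hj
    simp only [hc, hc', entry_add_smul_delta _ ε hl hi, entry_add_smul_delta _ ε hl hi',
      entry_add_smul_delta_of_ne _ ε hkl, entry_add_smul_delta_of_ne _ ε hkl.symm,
      entry_add_smul_delta_of_ne _ ε hkm.symm, entry_add_smul_delta_of_ne _ ε hlm.symm,
      ← hx, ← hy, ← hw]
    have e : ∀ u, rowCoeff τ (Icc 1 k) (Icc 1 l) x u j = rowProd τ (Icc 1 l) u (x j) *
      (rowProd τ ((Icc 1 k).erase j) x (x j))⁻¹ := fun u => div_eq_mul_inv _ _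
    simp only [e]
    ring
  · intro i hi i' hi' j hj
    have := serre_rowCoeff_second hε hR w (x j) (t := Icc 1 m) (fun _ _ => rfl) hi hi'
    linear_combination σ ^ 3 * (rowProd τ ((Icc 1 k).erase j) x (x j))⁻¹ * this

/-! ### The operators of the generators -/

lemma eCoeff_eq {n : ℕ} (τ : ℂ) (k : ℕ) (R : Tableau n) (j : ℕ) : eCoeff τ R k j =
    -1 * rowCoeff τ (Icc 1 k) (Icc 1 (k + 1)) (entry R k) (entry R (k + 1)) j :=
  (neg_one_mul _).symm

lemma fCoeff_eq {n : ℕ} (τ : ℂ) (k : ℕ) (R : Tableau n) (j : ℕ) : fCoeff τ R k j =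
    1 * rowCoeff τ (Icc 1 k) (Icc 1 (k - 1)) (entry R k) (entry R (k - 1)) j :=
  (one_mul _).symm

/-- Locality: only rows `k` and `k + 1` enter. -/
lemma eCoeff_add_smul_delta {n k l j : ℕ} (τ ε : ℂ) (R : Tableau n) (i : ℕ) (h : k ≠ l)
    (hnext : k + 1 ≠ l) : eCoeff τ (R + ε • delta n l j) k i = eCoeff τ R k i := by
  rw [eCoeff_eq, eCoeff_eq, entry_add_smul_delta_of_ne _ _ h, entry_add_smul_delta_of_ne _ _ hnext]

lemma fCoeff_add_smul_delta {n k l j : ℕ} (τ ε : ℂ) (R : Tableau n) (i : ℕ) (h : k ≠ l)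
    (hnext : k - 1 ≠ l) : fCoeff τ (R + ε • delta n l j) k i = fCoeff τ R k i := by
  rw [fCoeff_eq, fCoeff_eq, entry_add_smul_delta_of_ne _ _ h, entry_add_smul_delta_of_ne _ _ hnext]

/-- The action of `e_k` on formal combinations of tableaux. -/
def raising (n : ℕ) (τ : ℂ) (k : ℕ) : Module.End ℂ (Tableau n →₀ ℂ) :=
  ladder k 1 fun R j => eCoeff τ R k j

/-- The action of `f_k` on formal combinations of tableaux. -/
def lowering (n : ℕ) (τ : ℂ) (k : ℕ) : Module.End ℂ (Tableau n →₀ ℂ) :=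
  ladder k (-1) fun R j => fCoeff τ R k j

/-- The action of `q ^ h` on formal combinations of tableaux. -/
def torus {n : ℕ} (τ : ℂ) (h : Cartan n) : Module.End ℂ (Tableau n →₀ ℂ) :=
  diagonal fun R => qPow τ (weight h R)

/-! ### The defining relations on a basis tableau -/

section Relations

variable {n : ℕ} {τ : ℂ} (R : Tableau n)

lemma torus_single (h : Cartan n) (b : ℂ) :
    torus τ h (Finsupp.single R b) = Finsupp.single R (b * qPow τ (weight h R)) :=
  diagonal_single _ _ _

lemma torus_ladder_torus (h : Cartan n) (i : Fin (n - 1)) (ε : ℂ) (c : Tableau n → ℕ → ℂ) :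
    torus τ h (ladder (i + 1) ε c (torus τ (-h) (Finsupp.single R 1))) =
      qPow τ (ε * rootPairing h i) • ladder (i + 1) ε c (Finsupp.single R 1) := by
  simp only [torus_single, ladder_single, map_sum, smul_sum, Finsupp.smul_single, smul_eq_mul]
  refine sum_congr rfl fun j hj => ?_
  rw [weight_add_smul_delta h R ε i hj, weight_neg, qPow_add, qPow_neg]
  have := qPow_ne_zero τ (weight h R)
  congr 1
  field_simp

lemma raising_lowering_commutator (hτ : qPow τ 1 - qPow τ (-1) ≠ 0) (hR : IsGeneric τ R)
    (i : Fin (n - 1)) :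
    raising n τ (i + 1) (lowering n τ (i + 1) (Finsupp.single R 1)) -
        lowering n τ (i + 1) (raising n τ (i + 1) (Finsupp.single R 1)) =
      (qPow τ 1 - qPow τ (-1))⁻¹ • (torus τ (simpleRoot i) (Finsupp.single R 1) -
        torus τ (-simpleRoot i) (Finsupp.single R 1)) := by
  have hi : (i : ℕ) + 1 < n := by have := i.2; omega
  rw [raising, lowering, ladder_commutator]
  · rw [torus_single, torus_single, one_mul, one_mul, ← Finsupp.single_sub, Finsupp.smul_single,
      weight_neg, smul_eq_mul, inv_mul_eq_div]
    change _ = Finsupp.single R (qNum τ (weight (simpleRoot i) R))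
    rw [weight_simpleRoot, ← sum_rowCoeff_commutator hτ (by simp) (by simp) _ _ _
      (hR.qNum_ne_zero hτ hi)]
    congr 1
    refine sum_congr rfl fun j hj => ?_
    rw [eCoeff_eq, eCoeff_eq, fCoeff_eq, fCoeff_eq, entry_add_smul_delta _ _ hi.le hj,
      entry_add_smul_delta _ _ hi.le hj, entry_add_smul_delta_of_ne _ _ (by omega),
      entry_add_smul_delta_of_ne _ _ (by omega), Nat.add_sub_cancel]
    ring
  · intro a ha b hb hab
    rw [eCoeff_eq, eCoeff_eq, fCoeff_eq, fCoeff_eq, entry_add_smul_delta _ _ hi.le ha,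
      entry_add_smul_delta _ _ hi.le hb, entry_add_smul_delta_of_ne _ _ (by omega),
      entry_add_smul_delta_of_ne _ _ (by omega)]
    linear_combination -rowCoeff_comm_same_row τ _ _ _ _ _ ha hb hab 1

/-- The coefficients interact only for `l = k + 1`; otherwise neither operator sees the row moved by
the other. -/
lemma raising_lowering_comm {k l : ℕ} (hkn : k ≤ n) (hl : 1 ≤ l) (hln : l ≤ n)
    (hkl : k ≠ l) :
    raising n τ k (lowering n τ l (Finsupp.single R 1)) =
      lowering n τ l (raising n τ k (Finsupp.single R 1)) := by
  refine ladder_comm R fun i hi j hj => ?_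
  by_cases h : k + 1 = l
  · subst h
    rw [eCoeff_eq, eCoeff_eq, fCoeff_eq, fCoeff_eq, Nat.add_sub_cancel,
      entry_add_smul_delta _ _ hkn hj, entry_add_smul_delta _ _ hln hi, entry_add_smul_delta_of_ne _ _ hkl,
      entry_add_smul_delta_of_ne _ _ hkl.symm]
    linear_combination rowCoeff_comm_adjacent_rows τ (entry R k) (entry R (k + 1)) hj hi 1
  · rw [eCoeff_add_smul_delta τ _ R j hkl h,
      fCoeff_add_smul_delta τ _ R i hkl.symm (by omega), mul_comm]

lemma raising_comm {k l : ℕ} (h : k + 1 < l ∨ l + 1 < k) :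
    raising n τ k (raising n τ l (Finsupp.single R 1)) =
      raising n τ l (raising n τ k (Finsupp.single R 1)) := by
  refine ladder_comm R fun i _ j _ => ?_
  rw [eCoeff_add_smul_delta τ _ R j (by omega) (by omega),
    eCoeff_add_smul_delta τ _ R i (by omega) (by omega), mul_comm]

lemma lowering_comm {k l : ℕ} (h : k + 1 < l ∨ l + 1 < k) :
    lowering n τ k (lowering n τ l (Finsupp.single R 1)) =
      lowering n τ l (lowering n τ k (Finsupp.single R 1)) := by
  refine ladder_comm R fun i _ j _ => ?_
  rw [fCoeff_add_smul_delta τ _ R j (by omega) (by omega),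
    fCoeff_add_smul_delta τ _ R i (by omega) (by omega), mul_comm]

/-- `e_k` sees row `k + 1`, so the doubled operator depends on the other row exactly when the other
row is above. For `lowering_serre` the two cases are exchanged. -/
lemma raising_serre (hτ : qPow τ 1 - qPow τ (-1) ≠ 0) (hR : IsGeneric τ R) {k l : ℕ} (hk : k < n)
    (hl : l < n) (h : k + 1 = l ∨ l + 1 = k) :
    raising n τ k (raising n τ k (raising n τ l (Finsupp.single R 1))) -
        (qPow τ 1 + qPow τ (-1)) •
          raising n τ k (raising n τ l (raising n τ k (Finsupp.single R 1))) +
      raising n τ l (raising n τ k (raising n τ k (Finsupp.single R 1))) = 0 := by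
  rcases h with rfl | rfl
  · exact ladder_serre_first (.inl rfl) hk.le hl.le (by omega) (by omega) (eCoeff_eq τ _)
      (eCoeff_eq τ _) (hR.qNum_ne_zero hτ hk)
  · exact ladder_serre_second (.inl rfl) hk.le (by omega) (by omega) (by omega) (eCoeff_eq τ _)
      (eCoeff_eq τ _) (hR.qNum_ne_zero hτ hk)

lemma lowering_serre (hτ : qPow τ 1 - qPow τ (-1) ≠ 0) (hR : IsGeneric τ R) {k l : ℕ}
    (hk1 : 1 ≤ k) (hl1 : 1 ≤ l) (hk : k < n) (hl : l < n) (h : k + 1 = l ∨ l + 1 = k) :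
    lowering n τ k (lowering n τ k (lowering n τ l (Finsupp.single R 1))) -
        (qPow τ 1 + qPow τ (-1)) •
          lowering n τ k (lowering n τ l (lowering n τ k (Finsupp.single R 1))) +
      lowering n τ l (lowering n τ k (lowering n τ k (Finsupp.single R 1))) = 0 := by
  rcases h with rfl | rfl
  · exact ladder_serre_second (.inr rfl) hk.le (by omega) (by omega) (by omega) (fCoeff_eq τ _)
      (fCoeff_eq τ _) (hR.qNum_ne_zero hτ hk)
  · exact ladder_serre_first (.inr rfl) hk.le hl.le (by omega) (by omega) (fCoeff_eq τ _)
      (fCoeff_eq τ _) (hR.qNum_ne_zero hτ hk)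

end Relations

/-! ### The module `V_∅(T(L))` -/

lemma mapsTo_V {n : ℕ} {L : Tableau n} {A : Module.End ℂ (Tableau n →₀ ℂ)}
    (h : ∀ R ∈ basisTableaux L, A (Finsupp.single R 1) ∈ V L) : ∀ v ∈ V L, A v ∈ V L := by
  intro v hv
  induction hv using Submodule.span_induction with
  | mem v hv => obtain ⟨R, hR, rfl⟩ := hv; exact h R hR
  | zero => simp
  | add v w _ _ h1 h2 => rw [map_add]; exact add_mem h1 h2
  | smul a v _ h1 => rw [map_smul]; exact Submodule.smul_mem _ _ h1

lemma single_mem_V {n : ℕ} {L R : Tableau n} (hR : R ∈ basisTableaux L) (b : ℂ) :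
    Finsupp.single R b ∈ V L := by
  rw [← mul_one b, ← smul_eq_mul, ← Finsupp.smul_single]
  exact Submodule.smul_mem _ _ (tab hR).2

lemma end_V_ext {n : ℕ} {L : Tableau n} {A B : Module.End ℂ (V L)}
    (h : ∀ (R : Tableau n) (hR : R ∈ basisTableaux L), A (tab hR) = B (tab hR)) : A = B := by
  refine LinearMap.ext fun ⟨v, hv⟩ => ?_
  induction hv using Submodule.span_induction with
  | mem v hv => obtain ⟨R, hR, rfl⟩ := hv; exact h R hR
  | zero => exact (map_zero A).trans (map_zero B).symm
  | add v w hv hw h1 h2 =>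
    exact ((map_add A ⟨v, hv⟩ ⟨w, hw⟩).trans (congrArg₂ _ h1 h2)).trans (map_add B _ _).symm
  | smul a v hv h1 =>
    exact ((map_smul A a ⟨v, hv⟩).trans (congrArg _ h1)).trans (map_smul B _ _).symm

lemma ladder_mem_V {n k : ℕ} {ε : ℂ} (hε : ε = 1 ∨ ε = -1) (hk : k < n) (L : Tableau n)
    (c : Tableau n → ℕ → ℂ) : ∀ v ∈ V L, ladder k ε c v ∈ V L :=
  mapsTo_V fun R hR => by
    rw [ladder_single]
    exact Submodule.sum_mem _ fun j _ => single_mem_V (isShift_add_smul_delta hR hε hk) _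

lemma succ_lt_of_fin {n : ℕ} (i : Fin (n - 1)) : (i : ℕ) + 1 < n := by have := i.2; omega

/-- The action of the generators on `V_∅(T(L))`. -/
def genAction {n : ℕ} (τ : ℂ) (L : Tableau n) : Gen n → Module.End ℂ (V L)
  | .e i => (raising n τ (i + 1)).restrict (ladder_mem_V (.inl rfl) (succ_lt_of_fin i) L _)
  | .f i => (lowering n τ (i + 1)).restrict (ladder_mem_V (.inr rfl) (succ_lt_of_fin i) L _)
  | .qh h => (torus τ h).restrict (mapsTo_V fun R hR => by
      rw [torus_single]; exact single_mem_V hR _)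

lemma coe_tab {n : ℕ} {L R : Tableau n} (hR : R ∈ basisTableaux L) :
    (tab hR : Tableau n →₀ ℂ) = Finsupp.single R 1 := rfl

section GenAction

variable {n : ℕ} (τ : ℂ) {L : Tableau n} (v : V L)

lemma coe_genAction_e (i : Fin (n - 1)) : (genAction τ L (.e i) v : Tableau n →₀ ℂ) =
    raising n τ (i + 1) v := rfl

lemma coe_genAction_f (i : Fin (n - 1)) : (genAction τ L (.f i) v : Tableau n →₀ ℂ) =
    lowering n τ (i + 1) v := rfl

lemma coe_genAction_qh (h : Cartan n) : (genAction τ L (.qh h) v : Tableau n →₀ ℂ) =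
    torus τ h v := rfl

end GenAction

lemma coe_lift_genAction_sub {n : ℕ} (τ : ℂ) {L : Tableau n} (a b : FreeAlgebra ℂ (Gen n))
    (v : V L) : (FreeAlgebra.lift ℂ (genAction τ L) (a - b) v : Tableau n →₀ ℂ) =
      FreeAlgebra.lift ℂ (genAction τ L) a v - FreeAlgebra.lift ℂ (genAction τ L) b v := by
  rw [eq_sub_iff_add_eq, ← Submodule.coe_add, ← LinearMap.add_apply, ← map_add, sub_add_cancel]

lemma genAction_rel {n : ℕ} {τ : ℂ} (hτ : qPow τ 1 - qPow τ (-1) ≠ 0) {L : Tableau n}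
    (hL : IsGeneric τ L) {a b : FreeAlgebra ℂ (Gen n)} (hab : UqRel n τ a b) :
    FreeAlgebra.lift ℂ (genAction τ L) a = FreeAlgebra.lift ℂ (genAction τ L) b := by
  refine end_V_ext fun R hR => Subtype.ext ?_
  have hg : IsGeneric τ R := hL.of_isShift hR
  -- Each relation becomes an identity of ambient operators applied to `Finsupp.single R 1`.
  cases hab <;> simp only [map_mul, coe_lift_genAction_sub, map_add, map_smul, map_zero, map_one, sq,
    FreeAlgebra.lift_ι_apply, Module.End.mul_apply, Module.End.one_apply,
    LinearMap.add_apply, LinearMap.smul_apply, LinearMap.zero_apply,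
    Submodule.coe_add, Submodule.coe_smul, Submodule.coe_zero,
    coe_genAction_e, coe_genAction_f, coe_genAction_qh, coe_tab]
  case qh_zero => simp [torus_single, weight_zero]
  case qh_add h h' => rw [torus_single, torus_single, torus_single, weight_add, qPow_add]; ring_nf
  case qh_e h i => simpa [raising] using torus_ladder_torus R h i 1 _
  case qh_f h i => simpa [lowering] using torus_ladder_torus R h i (-1) _
  case ef_same i => exact raising_lowering_commutator R hτ hg i
  case ef_ne i j hij =>
    have hi := succ_lt_of_fin i
    have hj := succ_lt_of_fin j
    rw [raising_lowering_comm R hi.le (by omega) hj.le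
      (fun h => hij (Fin.ext (by omega))), sub_self]
  case serre_e i j hij =>
    refine raising_serre R hτ hg (succ_lt_of_fin i) (succ_lt_of_fin j) ?_
    rcases hij with h | h <;> omega
  case serre_f i j hij =>
    refine lowering_serre R hτ hg (by omega) (by omega) (succ_lt_of_fin i) (succ_lt_of_fin j) ?_
    rcases hij with h | h <;> omega
  case comm_e i j hij => exact raising_comm R (by rcases hij with h | h <;> omega)
  case comm_f i j hij => exact lowering_comm R (by rcases hij with h | h <;> omega)

/-- The Gelfand–Tsetlin representation of `U_q(gl_n)` on `V_∅(T(L))`. -/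
def gtRep {n : ℕ} {τ : ℂ} (hτ : qPow τ 1 - qPow τ (-1) ≠ 0) {L : Tableau n}
    (hL : IsGeneric τ L) : Uq n τ →ₐ[ℂ] Module.End ℂ (V L) :=
  RingQuot.liftAlgHom ℂ ⟨FreeAlgebra.lift ℂ (genAction τ L), fun _ _ h => genAction_rel hτ hL h⟩

lemma gtRep_mk {n : ℕ} {τ : ℂ} (hτ : qPow τ 1 - qPow τ (-1) ≠ 0) {L : Tableau n}
    (hL : IsGeneric τ L) (g : Gen n) :
    gtRep hτ hL (RingQuot.mkAlgHom ℂ (UqRel n τ) (FreeAlgebra.ι ℂ g)) = genAction τ L g := by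
  rw [gtRep, RingQuot.liftAlgHom_mkAlgHom_apply, FreeAlgebra.lift_ι_apply]

lemma gtRep_qh_tab {n : ℕ} {τ : ℂ} (hτ : qPow τ 1 - qPow τ (-1) ≠ 0) {L : Tableau n}
    (hL : IsGeneric τ L) (h : Cartan n) {R : Tableau n} (hR : R ∈ basisTableaux L) :
    gtRep hτ hL (Uq.qh τ h) (tab hR) = qPow τ (weight h R) • tab hR := by
  rw [Uq.qh, gtRep_mk]
  refine Subtype.ext ((torus_single R h 1).trans ?_)
  simp [tab]

end QuantumGT

end

theorem corollary3p12 (n : ℕ) (hn : 2 ≤ n) (q τ : ℂ) (hτ : Complex.exp τ = q)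
    (hq : ∀ m : ℕ, 0 < m → q ^ m ≠ 1)
    (L : QuantumGT.Tableau n) (hL : QuantumGT.IsGeneric τ L) :
    ∃ ρ : QuantumGT.Uq n τ →ₐ[ℂ] Module.End ℂ (QuantumGT.V L),
      ∀ (R : QuantumGT.Tableau n) (hR : R ∈ QuantumGT.basisTableaux L),
        -- `q ^ {ε_k}` acts by `q ^ {a_k}`
        (∀ k : Fin n,
          ρ (QuantumGT.Uq.qh τ (QuantumGT.eps k)) (QuantumGT.tab hR) =
            QuantumGT.qPow τ (QuantumGT.aCoeff R ((k : ℕ) + 1)) • QuantumGT.tab hR) ∧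
        -- more generally `q ^ h`, `h = ∑ h_k ε_k`, acts by `q ^ {∑ h_k a_k}`
        (∀ h : QuantumGT.Cartan n,
          ρ (QuantumGT.Uq.qh τ h) (QuantumGT.tab hR) =
            QuantumGT.qPow τ (∑ k : Fin n, h k * QuantumGT.aCoeff R ((k : ℕ) + 1)) •
              QuantumGT.tab hR) ∧
        -- the action of `e_k`, with `k = i + 1`
        (∀ i : Fin (n - 1),
          ((ρ (QuantumGT.Uq.e τ i) (QuantumGT.tab hR) : QuantumGT.V L) :
              QuantumGT.Tableau n →₀ ℂ) =
            ∑ j ∈ Finset.Icc 1 ((i : ℕ) + 1),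
              Finsupp.single (R + QuantumGT.delta n ((i : ℕ) + 1) j)
                (QuantumGT.eCoeff τ R ((i : ℕ) + 1) j)) ∧
        -- the action of `f_k`, with `k = i + 1`
        (∀ i : Fin (n - 1),
          ((ρ (QuantumGT.Uq.f τ i) (QuantumGT.tab hR) : QuantumGT.V L) :
              QuantumGT.Tableau n →₀ ℂ) =
            ∑ j ∈ Finset.Icc 1 ((i : ℕ) + 1),
              Finsupp.single (R - QuantumGT.delta n ((i : ℕ) + 1) j)
                (QuantumGT.fCoeff τ R ((i : ℕ) + 1) j)) := by
  have h0 : QuantumGT.qPow τ 1 - QuantumGT.qPow τ (-1) ≠ 0 :=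
    QuantumGT.qPow_one_sub_ne_zero (hτ ▸ hq)
  refine ⟨QuantumGT.gtRep h0 hL, fun R hR => ⟨fun k => ?_, fun h => ?_, fun i => ?_, fun i => ?_⟩⟩
  · rw [QuantumGT.gtRep_qh_tab, QuantumGT.weight_eps]
  · exact QuantumGT.gtRep_qh_tab h0 hL h hR
  · rw [QuantumGT.Uq.e, QuantumGT.gtRep_mk]
    refine (QuantumGT.ladder_single _ _ _ R 1).trans ?_
    simp only [one_smul, one_mul]
  · rw [QuantumGT.Uq.f, QuantumGT.gtRep_mk]
    refine (QuantumGT.ladder_single _ _ _ R 1).trans ?_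
    simp only [neg_smul, one_smul, one_mul, sub_eq_add_neg]
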